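/- \textbf{Theorem.} Let $n\ge 1$ and let $\psi\in H=(\mathbb{C}^2)^{\otimes n}$ be a nonzero $n$-qubit state vector. Let $G=U(1)\times SU(2)^n$ be the local unitary group, acting on $H$ by $\Phi((z,U_1,\dots,U_n),\psi)=z\,(U_1\otimes\cdots\otimes U_n)\psi$, let $\mathfrak g=u(1)\oplus su(2)^{\oplus n}$ be its (real) Lie algebra, and let $K_\psi=\ker d\Phi_\psi\subseteq\mathfrak g$ be the stabilizer subalgebra of $\psi$, where $d\Phi_\psi:\mathfrak g\to H$ is the derivative at the identity of the map $\Phi_\psi: G\to H$, $g\mapsto\Phi(g,\psi)$; explicitly, $d\Phi_\psi(x,X_1,\dots,X_n)=x\psi+\sum_{j=1}^n X_j^{(j)}\psi$, with $X_j^{(j)}$ acting as $X_j$ on qubit $j$ and as the identity on the other qubits. For $m\le n$, say that an $m$-qubit vector $\varphi$ is a factor of $\psi$ if, for some choice (and ordering) of $m$ of the $n$ qubits, $\psi$ is the tensor product of $\varphi$ on those qubits and some $(n-m)$-qubit vector on the others ($m=n$ is allowed, the second vector then being a scalar). Suppose that (i) $\psi$ has no singlet factor: no two-qubit vector of the form $\Phi(g,s)$,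 with $s=\tfrac1{\sqrt2}(|01\rangle-|10\rangle)$ and $g\in U(1)\times SU(2)^2$, is a factor of $\psi$; and (ii) $\psi$ has no single-qubit factor: no one-qubit vector is a factor of $\psi$. Then $\dim_{\mathbb R}K_\psi\le n-1$. -/

import Mathlib

noncomputable section

/-- The Hilbert space `(ℂ²)^{⊗ι}` of qubits labelled by `ι`, in the computational basis: the vector
`ψ = ∑_I c_I |I⟩` is the family of its coefficients `c_I`, indexed by the multi-indices
`I : ι → {0,1}`. The `n`-qubit Hilbert space is `QubitSpace (Fin n)`. -/
abbrev QubitSpace (ι : Type) [Fintype ι] : Type := EuclideanSpace ℂ (ι → Fin 2)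

/-- The local unitary group `G = U(1) × SU(2)^ι`. -/
abbrev LocalUnitaryGroup (ι : Type) : Type :=
  unitary ℂ × (ι → Matrix.specialUnitaryGroup (Fin 2) ℂ)

/-- The Lie algebra `u(1) = iℝ` of the phase group `U(1)`. -/
def u1 : Submodule ℝ ℂ := skewAdjoint.submodule ℝ ℂ

/-- The Lie algebra `su(2)` of traceless skew-Hermitian `2 × 2` matrices, over `ℝ`. -/
def su2 : Submodule ℝ (Matrix (Fin 2) (Fin 2) ℂ) :=
  skewAdjoint.submodule ℝ (Matrix (Fin 2) (Fin 2) ℂ) ⊓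
    LinearMap.ker (Matrix.traceLinearMap (Fin 2) ℝ ℂ)

/-- The Lie algebra `𝔤 = u(1) ⊕ ⨁_j su(2)` of the local unitary group, as a real vector space. -/
abbrev LocalUnitaryAlgebra (ι : Type) : Type := u1 × (ι → su2)

/-- The local unitary action `Φ(g, ψ) = z · (⨂_j U_j) ψ` for `g = (z, (U_j)_j)`; the
`(I, J)` entry of `⨂_j U_j` is `∏_j (U_j)_{I_j J_j}`. -/
def localUnitaryAction {ι : Type} [Fintype ι] [DecidableEq ι]
    (g : LocalUnitaryGroup ι) (ψ : QubitSpace ι) : QubitSpace ι :=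
  WithLp.toLp 2 fun I => (g.1 : ℂ) *
    ∑ J : ι → Fin 2, (∏ j, (g.2 j : Matrix (Fin 2) (Fin 2) ℂ) (I j) (J j)) * ψ J

/-- The derivative `dΦ_ψ : 𝔤 → H` at the identity of `Φ_ψ : g ↦ Φ(g, ψ)`, namely
`(x, (X_j)_j) ↦ x ψ + ∑_j X_j^{(j)} ψ`, where `X_j^{(j)}` is `X_j` acting on qubit `j` alone.
That this is the derivative is proved in `hasDerivAt_localUnitaryAction`. -/
def dPhi {ι : Type} [Fintype ι] [DecidableEq ι] (ψ : QubitSpace ι) :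
    LocalUnitaryAlgebra ι →ₗ[ℝ] QubitSpace ι where
  toFun X := WithLp.toLp 2 fun I => (X.1 : ℂ) * ψ I +
    ∑ j, ∑ a : Fin 2, (X.2 j : Matrix (Fin 2) (Fin 2) ℂ) (I j) a * ψ (Function.update I j a)
  map_add' X Y := by
    ext I
    simp [add_mul, Finset.sum_add_distrib]
    ring
  map_smul' c X := by
    ext I
    simp [mul_add, Finset.mul_sum, mul_assoc]

/-- The stabilizer subalgebra `K_ψ = ker dΦ_ψ ⊆ 𝔤`. -/
def stabilizerSubalgebra {ι : Type} [Fintype ι] [DecidableEq ι] (ψ : QubitSpace ι) :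
    Submodule ℝ (LocalUnitaryAlgebra ι) :=
  LinearMap.ker (dPhi ψ)

/-- Two vectors are LU-equivalent if a local unitary transformation takes one to the other. -/
def LUEquivalent {ι : Type} [Fintype ι] [DecidableEq ι] (φ φ' : QubitSpace ι) : Prop :=
  ∃ g : LocalUnitaryGroup ι, localUnitaryAction g φ = φ'

/-- The `m`-qubit vector `φ` is a factor of the `n`-qubit vector `ψ`: for some choice of `m` of the
qubits (listed by `e`), `ψ` is the tensor product of `φ` on these qubits and a vector `χ` on
the `n - m` other qubits. -/
def IsFactor {m n : ℕ} (φ : QubitSpace (Fin m)) (ψ : QubitSpace (Fin n)) : Prop :=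
  ∃ (e : Fin m ↪ Fin n) (χ : QubitSpace {k : Fin n // k ∉ Finset.univ.map e}),
    ∀ I : Fin n → Fin 2, ψ I = φ (fun k => I (e k)) * χ (fun k => I k)

/-- The two-qubit singlet `(|01⟩ - |10⟩) / √2`. -/
def singlet : QubitSpace (Fin 2) :=
  (((1 / Real.sqrt 2 : ℝ) : ℂ)) •
    (EuclideanSpace.single ![0, 1] 1 - EuclideanSpace.single ![1, 0] 1)

/-- `ψ` contains a singlet factor, where a singlet means the singlet or any LU-equivalent of it. -/
def HasSingletFactor {n : ℕ} (ψ : QubitSpace (Fin n)) : Prop :=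
  ∃ φ : QubitSpace (Fin 2), LUEquivalent singlet φ ∧ IsFactor φ ψ

/-- `ψ` contains a single qubit factor. For `n = 1` every vector is one. -/
def HasSingleQubitFactor {n : ℕ} (ψ : QubitSpace (Fin n)) : Prop :=
  ∃ φ : QubitSpace (Fin 1), IsFactor φ ψ

/-- `dPhi` is the derivative of `Φ_ψ` at the identity: if a curve in the local unitary group passes
through `1` at time `0` with velocity `X ∈ 𝔤`, then its image under `Φ_ψ` has velocity
`dΦ_ψ(X)` at time `0`. -/
theorem hasDerivAt_localUnitaryAction {ι : Type} [Fintype ι] [DecidableEq ι] (ψ : QubitSpace ι)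
    (X : LocalUnitaryAlgebra ι) (g : ℝ → LocalUnitaryGroup ι) (hg : g 0 = 1)
    (h0 : HasDerivAt (fun s => ((g s).1 : ℂ)) (X.1 : ℂ) 0)
    (h1 : ∀ j a b, HasDerivAt (fun s => ((g s).2 j : Matrix (Fin 2) (Fin 2) ℂ) a b)
      ((X.2 j : Matrix (Fin 2) (Fin 2) ℂ) a b) 0) :
    HasDerivAt (fun s => localUnitaryAction (g s) ψ) (dPhi ψ X) 0 := by
  have key : HasDerivAt (fun s => WithLp.ofLp (localUnitaryAction (g s) ψ))
      (WithLp.ofLp (dPhi ψ X)) 0 := by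
    rw [hasDerivAt_pi]
    intro I
    have hp : ∀ J : ι → Fin 2, HasDerivAt
        (fun s => (∏ j, ((g s).2 j : Matrix (Fin 2) (Fin 2) ℂ) (I j) (J j)) * ψ J)
        ((∑ j, (∏ k ∈ Finset.univ.erase j, (1 : Matrix (Fin 2) (Fin 2) ℂ) (I k) (J k)) *
          (X.2 j : Matrix (Fin 2) (Fin 2) ℂ) (I j) (J j)) * ψ J) 0 := by
      intro J
      have := (HasDerivAt.fun_finsetProd (u := Finset.univ)
        (fun j _ => h1 j (I j) (J j))).mul_const (ψ J)
      simpa [hg] using this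
    have hs := h0.mul (HasDerivAt.fun_sum (u := Finset.univ) (fun J _ => hp J))
    refine hs.congr_deriv ?_
    have e1 : ∑ J : ι → Fin 2, (∏ j, ((g 0).2 j : Matrix (Fin 2) (Fin 2) ℂ) (I j) (J j)) * ψ J
        = ψ I := by
      rw [Finset.sum_eq_single I]
      · simp [hg]
      · intro J _ hJ
        obtain ⟨k, hk⟩ := Function.ne_iff.mp hJ
        rw [Finset.prod_eq_zero (Finset.mem_univ k), zero_mul]
        simp [hg, hk.symm]
      · simp
    have e2 : ∀ j, ∑ J : ι → Fin 2,
        ((∏ k ∈ Finset.univ.erase j, (1 : Matrix (Fin 2) (Fin 2) ℂ) (I k) (J k)) *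
          (X.2 j : Matrix (Fin 2) (Fin 2) ℂ) (I j) (J j)) * ψ J =
        ∑ a : Fin 2, (X.2 j : Matrix (Fin 2) (Fin 2) ℂ) (I j) a * ψ (Function.update I j a) := by
      intro j
      symm
      apply Finset.sum_of_injOn (fun a => Function.update I j a)
      · intro a _ b _ hab
        exact Function.update_injective I j hab
      · simp
      · intro J _ hJ
        have : ∃ k, k ≠ j ∧ I k ≠ J k := by
          by_contra hcon
          push Not at hcon
          apply hJ
          refine ⟨J j, by simp, ?_⟩
          funext k
          by_cases hkj : k = j
          · subst hkj
            simp
          · simp [hkj, hcon k hkj]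
        obtain ⟨k, hkj, hk⟩ := this
        rw [Finset.prod_eq_zero (i := k) (by simp [hkj])]
        · ring
        · exact Matrix.one_apply_ne hk
      · intro a _
        have hone : ∏ k ∈ Finset.univ.erase j,
            (1 : Matrix (Fin 2) (Fin 2) ℂ) (I k) (Function.update I j a k) = 1 := by
          refine Finset.prod_eq_one fun k hk => ?_
          rw [Function.update_of_ne (Finset.ne_of_mem_erase hk), Matrix.one_apply_eq]
        rw [hone, one_mul, Function.update_self]
    rw [e1, Finset.sum_congr rfl fun J _ => Finset.sum_mul _ _ _, Finset.sum_comm,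
      Finset.sum_congr rfl fun j _ => e2 j]
    simp [hg, dPhi]
  exact (PiLp.hasFDerivAt_toLp (𝕜 := ℝ) 2 _).comp_hasDerivAt 0 key

end

/-! Identify su(2) with ℝ³, the bracket becoming twice the cross product. Then K_ψ embeds in a
subspace K of ℝ × (ℝ³)^n closed under sitewise cross products. The projection of K to one qubit is a
subalgebra of ℝ³, hence everything or of dimension at most 1. Group the qubits with full projection
into blocks, according to the kernel of the projection. A Goursat argument
(`exists_mem_vanishingOn`) gives elements of K without phase, supported on a single block, with
arbitrary component at a chosen qubit of it. Blocks of one or three qubits would force ψ = 0, and a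
block of two would give a singlet factor (`hasSingletFactor_of_pair`). So each block uses at least
four qubits (`four_le_card_block`) but adds only 3 to the dimension.

Every other qubit adds at most 1. The bound is strict: if there are no other qubits because 3 < 4,
and otherwise because one of them can be ignored. Indeed an element of K vanishing at all qubits but
one makes ψ an eigenvector of a one-qubit operator, so it is zero, phase included, when there is no
single-qubit factor. -/

open scoped Matrix

/-! ### Pauli coordinates on su(2) -/

/-- The traceless skew-Hermitian matrix `-i (v₀ σ_x + v₁ σ_y + v₂ σ_z)`. -/
noncomputable def pauliVector : (Fin 3 → ℝ) →ₗ[ℝ] Matrix (Fin 2) (Fin 2) ℂ where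
  toFun v := !![-Complex.I * v 2, -Complex.I * v 0 - v 1; -Complex.I * v 0 + v 1, Complex.I * v 2]
  map_add' v w := by
    ext a b
    fin_cases a <;> fin_cases b <;> simp <;> ring
  map_smul' c v := by
    ext a b
    fin_cases a <;> fin_cases b <;> simp <;> ring

theorem pauliVector_apply (v : Fin 3 → ℝ) : pauliVector v =
    !![-Complex.I * v 2, -Complex.I * v 0 - v 1; -Complex.I * v 0 + v 1, Complex.I * v 2] := rfl

theorem pauliVector_commutator (v w : Fin 3 → ℝ) :
    pauliVector v * pauliVector w - pauliVector w * pauliVector v =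
      (2 : ℂ) • pauliVector (crossProduct v w) := by
  ext a b
  fin_cases a <;> fin_cases b <;>
    simp [pauliVector_apply, cross_apply] <;> ring_nf <;>
    simp <;> ring

theorem pauliVector_mul_self (v : Fin 3 → ℝ) :
    pauliVector v * pauliVector v = (-((v ⬝ᵥ v : ℝ) : ℂ)) • 1 := by
  ext a b
  fin_cases a <;> fin_cases b <;>
    simp [pauliVector_apply, dotProduct, Matrix.mul_apply, Fin.sum_univ_two,
      Fin.sum_univ_three] <;> ring_nf <;> simp <;> ring

/-- The coordinates of a traceless skew-Hermitian matrix with respect to `pauliVector`. -/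
def pauliCoord : Matrix (Fin 2) (Fin 2) ℂ →ₗ[ℝ] (Fin 3 → ℝ) where
  toFun X := ![-(X 0 1).im, -(X 0 1).re, -(X 0 0).im]
  map_add' X Y := by
    ext a
    fin_cases a <;> simp <;> ring
  map_smul' c X := by
    ext a
    fin_cases a <;> simp

theorem pauliVector_pauliCoord {X : Matrix (Fin 2) (Fin 2) ℂ} (hX : X ∈ su2) :
    pauliVector (pauliCoord X) = X := by
  obtain ⟨h1, h2⟩ := hX
  have h1' : star X = -X := h1
  have h3 : X 0 0 + X 1 1 = 0 := by
    simpa [Matrix.trace_fin_two] using h2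
  have h00 := congrFun (congrFun h1' 0) 0
  have h01 := congrFun (congrFun h1' 1) 0
  simp only [Matrix.star_apply, Matrix.neg_apply, Complex.ext_iff, Complex.star_def,
    Complex.conj_re, Complex.conj_im, Complex.neg_re, Complex.neg_im] at h00 h01
  simp only [Complex.ext_iff, Complex.add_re, Complex.add_im, Complex.zero_re,
    Complex.zero_im] at h3
  ext a b
  fin_cases a <;> fin_cases b <;>
    simp [pauliVector_apply, pauliCoord, Complex.ext_iff] <;>
    (try constructor) <;> linarith [h00.1, h01.1, h01.2, h3.1, h3.2]

/-! ### One-site operators and the stabilizer in Pauli coordinates -/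

section SiteOperators

variable {ι : Type} [DecidableEq ι]

/-- The operator acting as the matrix `X` on the qubit `j` and as the identity elsewhere. -/
def siteOp (j : ι) (X : Matrix (Fin 2) (Fin 2) ℂ) : Module.End ℂ ((ι → Fin 2) → ℂ) where
  toFun f I := ∑ a : Fin 2, X (I j) a * f (Function.update I j a)
  map_add' f g := by
    ext I
    simp [mul_add, Finset.sum_add_distrib]
  map_smul' c f := by
    ext I
    simp only [Pi.smul_apply, smul_eq_mul, Fin.sum_univ_two, RingHom.id_apply]
    ring

theorem siteOp_apply (j : ι) (X : Matrix (Fin 2) (Fin 2) ℂ) (f : (ι → Fin 2) → ℂ)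
    (I : ι → Fin 2) :
    siteOp j X f I = ∑ a : Fin 2, X (I j) a * f (Function.update I j a) := rfl

theorem siteOp_mul (j : ι) (X Y : Matrix (Fin 2) (Fin 2) ℂ) :
    siteOp j (X * Y) = siteOp j X * siteOp j Y := by
  ext1 f
  ext I
  simp [siteOp_apply, Matrix.mul_apply, Fin.sum_univ_two]
  ring

theorem siteOp_one (j : ι) : siteOp j (1 : Matrix (Fin 2) (Fin 2) ℂ) = 1 := by
  ext1 f
  ext I
  simp [siteOp_apply, Matrix.one_apply]

theorem siteOp_add (j : ι) (X Y : Matrix (Fin 2) (Fin 2) ℂ) :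
    siteOp j (X + Y) = siteOp j X + siteOp j Y := by
  ext1 f
  ext I
  simp [siteOp_apply, add_mul, Finset.sum_add_distrib]

theorem siteOp_sub (j : ι) (X Y : Matrix (Fin 2) (Fin 2) ℂ) :
    siteOp j (X - Y) = siteOp j X - siteOp j Y := by
  ext1 f
  ext I
  simp [siteOp_apply, sub_mul, Finset.sum_sub_distrib]

theorem siteOp_smul (j : ι) (c : ℂ) (X : Matrix (Fin 2) (Fin 2) ℂ) :
    siteOp j (c • X) = c • siteOp j X := by
  ext1 f
  ext I
  simp [siteOp_apply, mul_assoc]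
  ring

theorem siteOp_zero (j : ι) : siteOp j (0 : Matrix (Fin 2) (Fin 2) ℂ) = 0 := by
  ext1 f
  ext I
  simp [siteOp_apply]

theorem siteOp_comm {j k : ι} (hjk : j ≠ k) (X Y : Matrix (Fin 2) (Fin 2) ℂ) :
    siteOp j X * siteOp k Y = siteOp k Y * siteOp j X := by
  ext1 f
  ext I
  simp only [Module.End.mul_apply, siteOp_apply, Fin.sum_univ_two,
    Function.update_of_ne hjk, Function.update_of_ne hjk.symm, Function.update_comm hjk]
  ring

variable [Fintype ι]

/-- The operator `i x + ∑_j E(u_j)^{(j)}` with `E = pauliVector`. -/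
noncomputable def localGenerator (k : ℝ × (ι → Fin 3 → ℝ)) : Module.End ℂ ((ι → Fin 2) → ℂ) :=
  (Complex.I * k.1) • 1 + ∑ j, siteOp j (pauliVector (k.2 j))

/-- The infinitesimal local unitaries, in Pauli coordinates, that annihilate `f`. -/
noncomputable def pauliStabilizer (f : (ι → Fin 2) → ℂ) : Submodule ℝ (ℝ × (ι → Fin 3 → ℝ)) where
  carrier := {k | localGenerator k f = 0}
  zero_mem' := by simp [localGenerator, siteOp_zero]
  add_mem' {k l} hk hl := by
    have : localGenerator (k + l) = localGenerator k + localGenerator l := by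
      simp [localGenerator, siteOp_add, Finset.sum_add_distrib, mul_add, add_smul]
      abel
    simp_all
  smul_mem' c k hk := by
    have : localGenerator (c • k) = (c : ℂ) • localGenerator k := by
      have h : ∀ X : Matrix (Fin 2) (Fin 2) ℂ, c • X = (c : ℂ) • X := fun X => by
        ext; simp
      simp only [localGenerator, Prod.smul_fst, Prod.smul_snd, Pi.smul_apply, map_smul, h,
        siteOp_smul, smul_add, Finset.smul_sum, smul_smul, smul_eq_mul, Complex.ofReal_mul]
      congr 2
      ring
    simp_all

theorem mem_pauliStabilizer {f : (ι → Fin 2) → ℂ} {k : ℝ × (ι → Fin 3 → ℝ)} :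
    k ∈ pauliStabilizer f ↔ localGenerator k f = 0 := Iff.rfl

theorem localGenerator_commutator (k l : ℝ × (ι → Fin 3 → ℝ)) :
    localGenerator k * localGenerator l - localGenerator l * localGenerator k =
      (2 : ℂ) • localGenerator (0, fun j => crossProduct (k.2 j) (l.2 j)) := by
  have hsum : (∑ j, siteOp j (pauliVector (k.2 j))) * (∑ j, siteOp j (pauliVector (l.2 j))) -
      (∑ j, siteOp j (pauliVector (l.2 j))) * (∑ j, siteOp j (pauliVector (k.2 j))) =
      ∑ j, (2 : ℂ) • siteOp j (pauliVector (crossProduct (k.2 j) (l.2 j))) := by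
    rw [Finset.sum_mul_sum, Finset.sum_mul_sum, Finset.sum_comm, ← Finset.sum_sub_distrib]
    refine Finset.sum_congr rfl fun j _ => ?_
    rw [← Finset.sum_sub_distrib, Finset.sum_eq_single j]
    · rw [← siteOp_mul, ← siteOp_mul, ← siteOp_sub, pauliVector_commutator, siteOp_smul]
    · intro i _ hij
      rw [siteOp_comm hij, sub_self]
    · simp
  simp only [localGenerator, Complex.ofReal_zero, mul_zero, zero_smul, zero_add]
  rw [Finset.smul_sum, ← hsum]
  simp only [add_mul, mul_add, smul_mul_assoc, mul_smul_comm, one_mul, mul_one]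
  module

theorem cross_mem_pauliStabilizer {f : (ι → Fin 2) → ℂ} {k l : ℝ × (ι → Fin 3 → ℝ)}
    (hk : k ∈ pauliStabilizer f) (hl : l ∈ pauliStabilizer f) :
    ((0, fun j => crossProduct (k.2 j) (l.2 j)) : ℝ × (ι → Fin 3 → ℝ)) ∈ pauliStabilizer f := by
  rw [mem_pauliStabilizer] at *
  have := congrArg (fun A => A f) (localGenerator_commutator k l)
  simpa [hk, hl] using this.symm

theorem finrank_stabilizerSubalgebra_le (ψ : QubitSpace ι) :
    Module.finrank ℝ (stabilizerSubalgebra ψ) ≤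
      Module.finrank ℝ (pauliStabilizer (WithLp.ofLp ψ)) := by
  let c : LocalUnitaryAlgebra ι →ₗ[ℝ] ℝ × (ι → Fin 3 → ℝ) :=
    { toFun := fun X => ((X.1 : ℂ).im, fun j => pauliCoord (X.2 j))
      map_add' := fun X Y => by ext <;> simp
      map_smul' := fun r X => by ext <;> simp }
  have hre : ∀ X : LocalUnitaryAlgebra ι, Complex.I * ((X.1 : ℂ).im : ℂ) = X.1 := fun X => by
    have h : star (X.1 : ℂ) = -X.1 := X.1.2
    have h' := congrArg Complex.re h
    simp at h'
    apply Complex.ext <;> simp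
    linarith
  have hc : ∀ X ∈ stabilizerSubalgebra ψ, c X ∈ pauliStabilizer (WithLp.ofLp ψ) := by
    intro X hX
    have hX' : dPhi ψ X = 0 := hX
    rw [mem_pauliStabilizer]
    ext I
    have h := congrFun (congrArg WithLp.ofLp hX') I
    simp only [c, localGenerator, LinearMap.coe_mk, AddHom.coe_mk, hre,
      pauliVector_pauliCoord (X.2 _).2]
    simpa [dPhi, siteOp_apply] using h
  refine LinearMap.finrank_le_finrank_of_injective (f := c.restrict hc) ?_
  intro X Y hXY
  have h : c X = c Y := congrArg Subtype.val hXY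
  ext1
  refine Prod.ext (Subtype.ext ?_) (funext fun j => Subtype.ext ?_)
  · rw [← hre X.1, ← hre Y.1]
    exact congrArg (fun x : ℝ × (ι → Fin 3 → ℝ) => Complex.I * (x.1 : ℂ)) h
  · rw [← pauliVector_pauliCoord (X.1.2 j).2, ← pauliVector_pauliCoord (Y.1.2 j).2]
    exact congrArg (fun x : ℝ × (ι → Fin 3 → ℝ) => pauliVector (x.2 j)) h

end SiteOperators

/-! ### Subalgebras and ideals of (ℝ³, ×) -/

section CrossProduct

/-- Simplicity of ℝ³ under ×, read off from w × (v × w) = (w·w) v - (v·w) w. -/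
theorem Submodule.eq_top_of_cross_mem {W : Submodule ℝ (Fin 3 → ℝ)}
    (hW : ∀ v, ∀ w ∈ W, crossProduct v w ∈ W) {w : Fin 3 → ℝ} (hw : w ∈ W) (hw0 : w ≠ 0) :
    W = ⊤ := by
  refine eq_top_iff.2 fun v _ => ?_
  have h0 : w ⬝ᵥ w ≠ 0 := fun h => hw0 (dotProduct_self_eq_zero.1 h)
  have h : crossProduct w (crossProduct v w) + (v ⬝ᵥ w) • w = (w ⬝ᵥ w) • v := by
    rw [cross_cross_eq_smul_sub_smul', dotProduct_comm v w]
    abel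
  have h1 : (w ⬝ᵥ w) • v ∈ W := h ▸ W.add_mem (hW _ _ (hW _ _ hw)) (W.smul_mem _ hw)
  exact (W.smul_mem_iff h0).1 h1

/-- If m = v × w ≠ 0 with v, w in W, then x × m lies in W for every x by the triple product formula,
and so does |m|² x = m × (x × m) + (x·m) m; thus W is everything. Otherwise all products vanish and
the vectors of W are parallel. -/
theorem Submodule.finrank_le_one_of_cross_mem {W : Submodule ℝ (Fin 3 → ℝ)}
    (hW : ∀ v ∈ W, ∀ w ∈ W, crossProduct v w ∈ W) (hne : W ≠ ⊤) : Module.finrank ℝ W ≤ 1 := by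
  have hcomm : ∀ v ∈ W, ∀ w ∈ W, crossProduct v w = 0 := by
    intro v hv w hw
    by_contra hn
    refine hne (eq_top_iff.2 fun x _ => ?_)
    set m := crossProduct v w with hm
    have h0 : m ⬝ᵥ m ≠ 0 := fun h => hn (dotProduct_self_eq_zero.1 h)
    have hmW : m ∈ W := hW v hv w hw
    have h : crossProduct m (crossProduct x m) + (x ⬝ᵥ m) • m = (m ⬝ᵥ m) • x := by
      rw [cross_cross_eq_smul_sub_smul', dotProduct_comm x m]
      abel
    have hx : crossProduct x m ∈ W := by
      rw [hm, cross_cross_eq_smul_sub_smul']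
      exact W.sub_mem (W.smul_mem _ hv) (W.smul_mem _ hw)
    have h1 : (m ⬝ᵥ m) • x ∈ W := h ▸ W.add_mem (hW _ hmW _ hx) (W.smul_mem _ hmW)
    exact (W.smul_mem_iff h0).1 h1
  by_cases hz : ∃ v ∈ W, v ≠ 0
  · obtain ⟨v, hv, hv0⟩ := hz
    have h0 : v ⬝ᵥ v ≠ 0 := fun h => hv0 (dotProduct_self_eq_zero.1 h)
    refine finrank_le_one (⟨v, hv⟩ : W) fun w => ⟨(v ⬝ᵥ v)⁻¹ * (v ⬝ᵥ w), ?_⟩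
    have h : (v ⬝ᵥ v) • (w : Fin 3 → ℝ) = (v ⬝ᵥ w) • v := by
      have h2 := cross_cross_eq_smul_sub_smul' v (w : Fin 3 → ℝ) v
      rw [hcomm _ w.2 _ hv, map_zero] at h2
      rw [dotProduct_comm v (w : Fin 3 → ℝ)]
      exact sub_eq_zero.1 h2.symm
    ext1
    simp only [Submodule.coe_smul, mul_smul]
    rw [← h, smul_smul, inv_mul_cancel₀ h0, one_smul]
  · push Not at hz
    rw [(Submodule.eq_bot_iff W).2 hz, finrank_bot]
    exact zero_le_one

/-- The three vectors are pairwise orthogonal, so each squared length is the product of the other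
two. -/
theorem dotProduct_self_eq_one_of_cross_cycle {u v w : Fin 3 → ℝ} (hu : u ≠ 0)
    (huv : crossProduct u v = w) (hvw : crossProduct v w = u) (hwu : crossProduct w u = v) :
    u ⬝ᵥ u = 1 := by
  have nonneg : ∀ x : Fin 3 → ℝ, 0 ≤ x ⬝ᵥ x := fun x =>
    Finset.sum_nonneg fun i _ => mul_self_nonneg (x i)
  have o1 : u ⬝ᵥ v = 0 := by rw [← hwu]; exact dot_cross_self _ _
  have o2 : v ⬝ᵥ w = 0 := by rw [← huv]; exact dot_cross_self _ _
  have o3 : w ⬝ᵥ u = 0 := by rw [← hvw]; exact dot_cross_self _ _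
  have n1 := cross_dot_cross u v u v
  have n2 := cross_dot_cross v w v w
  have n3 := cross_dot_cross w u w u
  rw [huv, o1] at n1
  rw [hvw, o2] at n2
  rw [hwu, o3] at n3
  simp only [zero_mul, sub_zero] at n1 n2 n3
  have h0 : 0 < u ⬝ᵥ u := lt_of_le_of_ne (nonneg u)
    fun h => hu (dotProduct_self_eq_zero.1 h.symm)
  have hw1 : (w ⬝ᵥ w) * (w ⬝ᵥ w) = 1 := by
    have : (u ⬝ᵥ u) * ((w ⬝ᵥ w) * (w ⬝ᵥ w)) = (u ⬝ᵥ u) * 1 := by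
      rw [n3] at n2
      linarith
    exact mul_left_cancel₀ h0.ne' this
  have hw2 : w ⬝ᵥ w = 1 := by nlinarith [nonneg w]
  rw [n3, hw2] at n1
  nlinarith

end CrossProduct

/-! ### Goursat argument: separating blocks of qubits -/

section Blocks

variable {ι : Type}

/-- The component at `j` of the elements of a subspace `K` of `ℝ × (ℝ³)^ι`. -/
def siteProj (K : Submodule ℝ (ℝ × (ι → Fin 3 → ℝ))) (j : ι) : K →ₗ[ℝ] (Fin 3 → ℝ) :=
  (LinearMap.proj j ∘ₗ LinearMap.snd ℝ ℝ (ι → Fin 3 → ℝ)).domRestrict K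

variable {K : Submodule ℝ (ℝ × (ι → Fin 3 → ℝ))}

/-- A kernel has codimension at most 3, and exactly 3 at `b`, so an inclusion is an equality. Hence
if the kernels differ, some element vanishes at `j` but not at `b`. -/
theorem surjective_siteProj_of_ker_le [Finite ι] {b j : ι} (hb : Function.Surjective (siteProj K b))
    (h : LinearMap.ker (siteProj K j) ≤ LinearMap.ker (siteProj K b)) :
    Function.Surjective (siteProj K j) ∧
      LinearMap.ker (siteProj K j) = LinearMap.ker (siteProj K b) := by
  have hle := Submodule.finrank_mono h
  have hj := (siteProj K j).finrank_range_add_finrank_ker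
  have hb' := (siteProj K b).finrank_range_add_finrank_ker
  rw [LinearMap.range_eq_top.2 hb, finrank_top, Module.finrank_fin_fun] at hb'
  have h3 : Module.finrank ℝ (LinearMap.range (siteProj K j)) ≤ 3 := by
    simpa using (LinearMap.range (siteProj K j)).finrank_le
  constructor
  · rw [← LinearMap.range_eq_top]
    apply Submodule.eq_top_of_finrank_eq
    rw [Module.finrank_fin_fun]
    omega
  · exact Submodule.eq_of_le_of_finrank_eq h (by omega)

/-- The pointwise bracket `((x, u), (y, v)) ↦ (0, u × v)` preserves `K`. -/
def IsCrossClosed (K : Submodule ℝ (ℝ × (ι → Fin 3 → ℝ))) : Prop :=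
  ∀ k ∈ K, ∀ l ∈ K, ((0, fun j => crossProduct (k.2 j) (l.2 j)) : ℝ × (ι → Fin 3 → ℝ)) ∈ K

theorem finrank_range_siteProj_le_one (hK : IsCrossClosed K) {j : ι}
    (hj : ¬ Function.Surjective (siteProj K j)) :
    Module.finrank ℝ (LinearMap.range (siteProj K j)) ≤ 1 := by
  refine Submodule.finrank_le_one_of_cross_mem ?_ (fun h => hj (LinearMap.range_eq_top.1 h))
  rintro _ ⟨k, rfl⟩ _ ⟨l, rfl⟩
  exact ⟨⟨_, hK k k.2 l l.2⟩, rfl⟩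

/-- If `P` absorbs brackets, then a surjective component `b` of `K` stays surjective on `K ∩ P` as soon
as it does not vanish there. -/
theorem exists_mem_of_ideal (hK : IsCrossClosed K) {b : ι}
    (hb : Function.Surjective (siteProj K b)) (P : Submodule ℝ (ℝ × (ι → Fin 3 → ℝ)))
    (hP : ∀ k : ℝ × (ι → Fin 3 → ℝ), ∀ l ∈ P,
      ((0, fun j => crossProduct (k.2 j) (l.2 j)) : ℝ × (ι → Fin 3 → ℝ)) ∈ P)
    {k : ℝ × (ι → Fin 3 → ℝ)} (hk : k ∈ K) (hkP : k ∈ P) (hkb : k.2 b ≠ 0) (w : Fin 3 → ℝ) :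
    ∃ l ∈ K, l ∈ P ∧ l.2 b = w := by
  have htop : (P.comap K.subtype).map (siteProj K b) = ⊤ := by
    refine Submodule.eq_top_of_cross_mem ?_ (w := k.2 b) ⟨⟨k, hk⟩, hkP, rfl⟩ hkb
    rintro v _ ⟨l, hl, rfl⟩
    obtain ⟨m, rfl⟩ := hb v
    exact ⟨⟨_, hK m m.2 l l.2⟩, hP m l hl, rfl⟩
  have hw : w ∈ (P.comap K.subtype).map (siteProj K b) := htop ▸ Submodule.mem_top
  obtain ⟨l, hl, rfl⟩ := hw
  exact ⟨l, l.2, hl, rfl⟩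

/-- The elements of `ℝ × (ℝ³)^ι` without phase that vanish on `F`. -/
def vanishingOn (F : Finset ι) : Submodule ℝ (ℝ × (ι → Fin 3 → ℝ)) where
  carrier := {k | k.1 = 0 ∧ ∀ j ∈ F, k.2 j = 0}
  zero_mem' := by simp
  add_mem' := by
    rintro k l ⟨h1, h2⟩ ⟨h3, h4⟩
    exact ⟨by simp [h1, h3], fun j hj => by simp [h2 j hj, h4 j hj]⟩
  smul_mem' := by
    rintro c k ⟨h1, h2⟩
    exact ⟨by simp [h1], fun j hj => by simp [h2 j hj]⟩

theorem cross_mem_vanishingOn {F : Finset ι} (k l : ℝ × (ι → Fin 3 → ℝ))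
    (hl : ∀ j ∈ F, l.2 j = 0) :
    ((0, fun j => crossProduct (k.2 j) (l.2 j)) : ℝ × (ι → Fin 3 → ℝ)) ∈ vanishingOn F :=
  ⟨rfl, fun j hj => by simp [hl j hj]⟩

/-- A surjective component `b` stays surjective on the elements of `K` that have no phase and vanish
at all sites whose component has a kernel different from that of `b`. -/
theorem exists_mem_vanishingOn [Finite ι] [DecidableEq ι] (hK : IsCrossClosed K) {b : ι}
    (hb : Function.Surjective (siteProj K b)) (F : Finset ι)
    (hF : ∀ j ∈ F, LinearMap.ker (siteProj K j) ≠ LinearMap.ker (siteProj K b))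
    (w : Fin 3 → ℝ) : ∃ k ∈ K, k ∈ vanishingOn F ∧ k.2 b = w := by
  have hcross : crossProduct ![1, 0, 0] ![0, 1, 0] ≠ (0 : Fin 3 → ℝ) := by
    intro h
    simpa [cross_apply] using congrFun h 2
  induction F using Finset.induction_on generalizing w with
  | empty =>
    -- A bracket has no phase; bracketing lifts of two basis vectors therefore removes the phase and
    -- stays nonzero at `b`.
    obtain ⟨k, hk⟩ := hb ![1, 0, 0]
    obtain ⟨l, hl⟩ := hb ![0, 1, 0]
    refine exists_mem_of_ideal hK hb (vanishingOn _) (fun k l hl => cross_mem_vanishingOn k l hl.2)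
      (hK k k.2 l l.2) (cross_mem_vanishingOn _ _ (by simp)) ?_ w
    change crossProduct (siteProj K b k) (siteProj K b l) ≠ 0
    rwa [hk, hl]
  | insert j F _ ih =>
    have hj : ∃ l ∈ K, l ∈ LinearMap.ker (LinearMap.proj (R := ℝ) (φ := fun _ : ι => Fin 3 → ℝ) j
        ∘ₗ LinearMap.snd ℝ ℝ (ι → Fin 3 → ℝ)) ∧ l.2 b = ![0, 1, 0] := by
      have hn : ¬ LinearMap.ker (siteProj K j) ≤ LinearMap.ker (siteProj K b) := fun h =>
        hF j (Finset.mem_insert_self _ _) (surjective_siteProj_of_ker_le hb h).2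
      obtain ⟨l, hl, hlb⟩ := SetLike.not_le_iff_exists.1 hn
      refine exists_mem_of_ideal hK hb _ (fun k l hl => ?_) l.2 hl hlb _
      have hl' : l.2 j = 0 := hl
      simp [hl']
    obtain ⟨l, hlK, hlj, hlb⟩ := hj
    obtain ⟨k, hkK, hkF, hkb⟩ :=
      ih (fun i hi => hF i (Finset.mem_insert_of_mem hi)) ![1, 0, 0]
    -- The bracket of an element vanishing on `F` with one vanishing at `j` vanishes on both, and
    -- its component at `b` is e₁ × e₂ ≠ 0.
    refine exists_mem_of_ideal hK hb (vanishingOn _) (fun k l hl => cross_mem_vanishingOn k l hl.2)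
      (hK k hkK l hlK) (⟨rfl, fun i hi => ?_⟩ : _ ∧ _) ?_ w
    · rcases Finset.mem_insert.1 hi with rfl | hi
      · have hl' : l.2 i = 0 := hlj
        simp [hl']
      · simp [hkF.2 i hi]
    · change crossProduct (k.2 b) (l.2 b) ≠ 0
      rwa [hkb, hlb]

end Blocks

/-! ### Blocks have at least four qubits; the dimension count -/

section BlockSize

variable {ι : Type} [DecidableEq ι]

theorem siteOp_pauliVector_sq (j : ι) (v : Fin 3 → ℝ) (f : (ι → Fin 2) → ℂ) :
    siteOp j (pauliVector v) (siteOp j (pauliVector v) f) = (-((v ⬝ᵥ v : ℝ) : ℂ)) • f := by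
  rw [← Module.End.mul_apply, ← siteOp_mul, pauliVector_mul_self, siteOp_smul, siteOp_one]
  rfl

/-- P + Q + R is invertible: since (PQ)² = 1, multiplying it by P + Q - R gives 2PQ - 1, and then by
2PQ + 1 gives 3. -/
theorem eq_zero_of_three_commuting {V : Type*} [AddCommGroup V] [Module ℂ V]
    {P Q R : Module.End ℂ V} (hPQ : P * Q = Q * P) (hP : P * P = -1) (hQ : Q * Q = -1)
    (hR : R * R = -1) (hPR : P * R = R * P) (hQR : Q * R = R * Q) {f : V}
    (h : (P + Q + R) f = 0) : f = 0 := by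
  have h1 : ((2 : ℂ) • (P * Q) - 1) * ((2 : ℂ) • (P * Q) + 1) = (3 : ℂ) • 1 := by
    have : P * Q * (P * Q) = 1 := by
      calc P * Q * (P * Q) = P * (Q * P) * Q := by noncomm_ring
        _ = (P * P) * (Q * Q) := by rw [← hPQ]; noncomm_ring
        _ = 1 := by rw [hP, hQ]; simp
    simp only [sub_mul, mul_add, smul_mul_assoc, mul_smul_comm, one_mul, mul_one, this]
    module
  have h2 : (P + Q - R) * (P + Q + R) = (2 : ℂ) • (P * Q) - 1 := by
    have : (P + Q - R) * (P + Q + R) = P * P + Q * Q - R * R + P * Q + Q * P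
      + (P * R - R * P) + (Q * R - R * Q) := by noncomm_ring
    rw [this, hP, hQ, hR, hPR, hQR, ← hPQ]
    module
  have hc : ((2 : ℂ) • (P * Q) - 1) * ((2 : ℂ) • (P * Q) + 1) =
      ((2 : ℂ) • (P * Q) + 1) * ((2 : ℂ) • (P * Q) - 1) := by
    simp only [sub_mul, mul_sub, add_mul, mul_add, one_mul, mul_one]
    abel
  rw [hc, ← h2] at h1
  have h3 := congrArg (fun A : Module.End ℂ V => A f) h1
  simp only [Module.End.mul_apply, h, map_zero, LinearMap.smul_apply, Module.End.one_apply] at h3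
  exact (smul_eq_zero.1 h3.symm).resolve_left (by norm_num)

variable [Fintype ι]

theorem sum_siteOp_eq_zero {f : (ι → Fin 2) → ℂ} {k : ℝ × (ι → Fin 3 → ℝ)} {B : Finset ι}
    (hk : k ∈ pauliStabilizer f) (hkB : k ∈ vanishingOn Bᶜ) :
    ∑ j ∈ B, siteOp j (pauliVector (k.2 j)) f = 0 := by
  rw [mem_pauliStabilizer] at hk
  simp only [localGenerator, hkB.1, Complex.ofReal_zero, mul_zero, zero_smul, zero_add,
    LinearMap.sum_apply] at hk
  rw [← hk]
  refine Finset.sum_subset (Finset.subset_univ B) fun j _ hj => ?_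
  simp [hkB.2 j (Finset.mem_compl.2 hj), siteOp_zero]

theorem isCrossClosed_pauliStabilizer (f : (ι → Fin 2) → ℂ) :
    IsCrossClosed (pauliStabilizer f) :=
  fun _ hk _ hl => cross_mem_pauliStabilizer hk hl

open Classical in
/-- A qubit on which the stabilizer of `f` projects onto `su(2)` shares its kernel with at least
three others, unless two qubits alone carry a copy of `su(2)`. -/
theorem four_le_card_block {f : (ι → Fin 2) → ℂ} (hf : f ≠ 0)
    (hpair : ∀ b c : ι, b ≠ c → ¬ ∀ v, ∃ w,
      siteOp b (pauliVector v) f + siteOp c (pauliVector w) f = 0)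
    {b : ι} (hb : Function.Surjective (siteProj (pauliStabilizer f) b)) :
    4 ≤ (Finset.univ.filter fun j => LinearMap.ker (siteProj (pauliStabilizer f) j) =
      LinearMap.ker (siteProj (pauliStabilizer f) b)).card := by
  set K := pauliStabilizer f with hKdef
  set B := Finset.univ.filter fun j => LinearMap.ker (siteProj K j) =
      LinearMap.ker (siteProj K b) with hB
  have hK : IsCrossClosed K := isCrossClosed_pauliStabilizer f
  have hbB : b ∈ B := by simp [hB]
  have hex : ∀ w, ∃ k ∈ K, k ∈ vanishingOn Bᶜ ∧ k.2 b = w :=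
    exists_mem_vanishingOn hK hb Bᶜ fun j hj => by simpa [hB] using hj
  by_contra hlt
  have hpos : 0 < B.card := Finset.card_pos.2 ⟨b, hbB⟩
  have hcases : B.card = 1 ∨ B.card = 2 ∨ B.card = 3 := by omega
  rcases hcases with h | h | h
  -- One site: an operator with square -1 would annihilate `f`.
  · obtain ⟨a, ha⟩ := Finset.card_eq_one.1 h
    obtain rfl : b = a := by simpa [ha] using hbB
    obtain ⟨k, hk, hkB, hkb⟩ := hex ![1, 0, 0]
    have h0 := sum_siteOp_eq_zero hk hkB
    rw [ha, Finset.sum_singleton, hkb] at h0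
    have h1 := siteOp_pauliVector_sq b ![1, 0, 0] f
    rw [h0, map_zero] at h1
    simp [dotProduct, Fin.sum_univ_three] at h1
    exact hf h1
  · obtain ⟨c, hc, hcB⟩ : ∃ c, b ≠ c ∧ B = {b, c} := by
      obtain ⟨x, y, hxy, hBxy⟩ := Finset.card_eq_two.1 h
      rw [hBxy] at hbB
      rcases Finset.mem_insert.1 hbB with rfl | hy
      · exact ⟨y, hxy, hBxy⟩
      · obtain rfl := Finset.mem_singleton.1 hy
        exact ⟨x, hxy.symm, by rw [hBxy, Finset.pair_comm]⟩
    refine hpair b c hc fun v => ?_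
    obtain ⟨k, hk, hkB, hkb⟩ := hex v
    have h0 := sum_siteOp_eq_zero hk hkB
    rw [hcB, Finset.sum_pair hc, hkb] at h0
    exact ⟨_, h0⟩
  · obtain ⟨x, y, z, hxy, hxz, hyz, hBxyz⟩ := Finset.card_eq_three.1 h
    obtain ⟨k, hk, hkB, hkb⟩ := hex ![1, 0, 0]
    obtain ⟨l, hl, hlB, hlb⟩ := hex ![0, 1, 0]
    -- Kernels agree on the block, so identities between elements of K checked at `b` hold at every
    -- site of the block. Applied to e₁, e₂, e₁ × e₂ at `b`, this makes every `k.2 j` a unit vector,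
    -- hence its operator squares to -1.
    have hker : ∀ m ∈ K, ∀ j ∈ B, m.2 b = 0 ↔ m.2 j = 0 := by
      intro m hm j hj
      have hj' : LinearMap.ker (siteProj K j) = LinearMap.ker (siteProj K b) := by
        simpa [hB] using hj
      have := SetLike.ext_iff.1 hj' ⟨m, hm⟩
      exact this.symm
    have hkl := hK k hk l hl
    have hlkl := K.sub_mem (hK l hl _ hkl) hk
    have hklk := K.sub_mem (hK _ hkl k hk) hl
    have hnorm : ∀ j ∈ B, k.2 j ⬝ᵥ k.2 j = 1 := by
      intro j hj
      refine dotProduct_self_eq_one_of_cross_cycle (v := l.2 j) ?_ rfl ?_ ?_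
      · intro hz
        have := (hker k hk j hj).2 hz
        rw [hkb] at this
        simpa using congrFun this 0
      · refine sub_eq_zero.1 ((hker _ hlkl j hj).1 ?_)
        change crossProduct (l.2 b) (crossProduct (k.2 b) (l.2 b)) - k.2 b = 0
        rw [hkb, hlb]
        ext i
        fin_cases i <;> simp [cross_apply]
      · refine sub_eq_zero.1 ((hker _ hklk j hj).1 ?_)
        change crossProduct (crossProduct (k.2 b) (l.2 b)) (k.2 b) - l.2 b = 0
        rw [hkb, hlb]
        ext i
        fin_cases i <;> simp [cross_apply]
    have h0 := sum_siteOp_eq_zero hk hkB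
    have hsq : ∀ j ∈ B, siteOp j (pauliVector (k.2 j)) * siteOp j (pauliVector (k.2 j)) = -1 := by
      intro j hj
      rw [← siteOp_mul, pauliVector_mul_self, hnorm j hj, siteOp_smul, siteOp_one,
        Complex.ofReal_one]
      exact neg_one_smul ℂ (1 : Module.End ℂ ((ι → Fin 2) → ℂ))
    rw [hBxyz, Finset.sum_insert (by simp [hxy, hxz]), Finset.sum_pair hyz, ← add_assoc] at h0
    exact hf (eq_zero_of_three_commuting (siteOp_comm hxy _ _)
      (hsq x (by simp [hBxyz])) (hsq y (by simp [hBxyz])) (hsq z (by simp [hBxyz]))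
      (siteOp_comm hxz _ _) (siteOp_comm hyz _ _) h0)

open Classical in
/-- The dimension count behind the bound on the stabilizer. -/
theorem finrank_pauliStabilizer_lt [Nonempty ι] {f : (ι → Fin 2) → ℂ} (hf : f ≠ 0)
    (hpair : ∀ b c : ι, b ≠ c → ¬ ∀ v, ∃ w,
      siteOp b (pauliVector v) f + siteOp c (pauliVector w) f = 0)
    (heigen : ∀ (j : ι) (v : Fin 3 → ℝ) (c : ℂ), v ≠ 0 → siteOp j (pauliVector v) f ≠ c • f) :
    Module.finrank ℝ (pauliStabilizer f) < Fintype.card ι := by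
  set K := pauliStabilizer f with hKdef
  have hK : IsCrossClosed K := isCrossClosed_pauliStabilizer f
  let κ : ι → Submodule ℝ K := fun j => LinearMap.ker (siteProj K j)
  let S : Finset ι := Finset.univ.filter fun j => Function.Surjective (siteProj K j)
  let C : Finset (Submodule ℝ K) := S.image κ
  have hC : ∀ c : C, ∃ j ∈ S, κ j = c := fun c => Finset.mem_image.1 c.2
  choose r hrS hrκ using hC
  -- `j₀` is the site left out of the count; it is arbitrary when all projections are surjective,
  -- and then erasing it changes nothing.
  obtain ⟨j₀, hj₀⟩ : ∃ j₀ : ι, Sᶜ = ∅ ∨ j₀ ∈ Sᶜ := by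
    rcases Sᶜ.eq_empty_or_nonempty with h | ⟨j, hj⟩
    · exact ⟨Classical.arbitrary ι, Or.inl h⟩
    · exact ⟨j, Or.inr hj⟩
  let T : Finset ι := Sᶜ.erase j₀
  let m : K →ₗ[ℝ] (C → Fin 3 → ℝ) × (∀ j : T, LinearMap.range (siteProj K j)) :=
    (LinearMap.pi fun c => siteProj K (r c)).prod
      (LinearMap.pi fun j => (siteProj K j).rangeRestrict)
  have hm : Function.Injective m := by
    rw [← LinearMap.ker_eq_bot, Submodule.eq_bot_iff]
    intro k hk
    have hk1 : ∀ c : C, k ∈ κ (r c) := fun c => congrFun (congrArg Prod.fst hk) c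
    have hk2 : ∀ j : T, k.1.2 j = 0 := fun j =>
      congrArg Subtype.val (congrFun (congrArg Prod.snd hk) j)
    -- One representative per block suffices, since all its sites have the same kernel.
    have hoff : ∀ j, j ≠ j₀ → k.1.2 j = 0 := by
      intro j hj
      by_cases hjS : j ∈ S
      · have := hk1 ⟨κ j, Finset.mem_image_of_mem κ hjS⟩
        rw [hrκ] at this
        exact this
      · exact hk2 ⟨j, Finset.mem_erase.2 ⟨hj, Finset.mem_compl.2 hjS⟩⟩
    have h0 : localGenerator k.1 f = 0 := k.2
    simp only [localGenerator, LinearMap.add_apply, LinearMap.sum_apply] at h0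
    rw [Finset.sum_eq_single j₀ (fun j _ hj => by simp [hoff j hj, siteOp_zero]) (by simp)] at h0
    have hj₀0 : k.1.2 j₀ = 0 := by
      by_contra hne
      refine heigen j₀ _ (-(Complex.I * k.1.1)) hne ?_
      rw [neg_smul]
      exact eq_neg_of_add_eq_zero_right h0
    have hx : k.1.1 = 0 := by
      rw [hj₀0, map_zero, siteOp_zero, LinearMap.zero_apply, add_zero] at h0
      simpa [hf] using h0
    refine Subtype.ext (Prod.ext hx (funext fun j => ?_))
    by_cases hj : j = j₀
    · rw [hj]
      exact hj₀0
    · exact hoff j hj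
  have hle := LinearMap.finrank_le_finrank_of_injective hm
  rw [Module.finrank_prod, Module.finrank_pi_fintype ℝ (M := fun _ : C => Fin 3 → ℝ),
    Module.finrank_pi_fintype ℝ (M := fun j : T => LinearMap.range (siteProj K j))] at hle
  have hT : ∑ j : T, Module.finrank ℝ (LinearMap.range (siteProj K j)) ≤ T.card := by
    refine (Finset.sum_le_card_nsmul _ _ 1 fun j _ => finrank_range_siteProj_le_one hK ?_).trans ?_
    · have := Finset.mem_compl.1 (Finset.mem_of_mem_erase j.2)
      simpa [S] using this
    · simp
  have h4 : 4 * C.card ≤ S.card := by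
    refine Finset.mul_card_image_le_card (f := κ) S 4 ?_
    intro c hc
    obtain ⟨b, hbS, rfl⟩ := Finset.mem_image.1 hc
    have hb : Function.Surjective (siteProj K b) := (Finset.mem_filter.1 hbS).2
    refine (four_le_card_block hf hpair hb).trans (Finset.card_le_card fun j hj => ?_)
    have hj' : κ j = κ b := (Finset.mem_filter.1 hj).2
    exact Finset.mem_filter.2 ⟨Finset.mem_filter.2 ⟨Finset.mem_univ _,
      (surjective_siteProj_of_ker_le hb hj'.le).1⟩, hj'⟩
  have hcard : S.card + Sᶜ.card = Fintype.card ι := Finset.card_add_card_compl S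
  have hsum : ∑ _c : C, Module.finrank ℝ (Fin 3 → ℝ) = 3 * C.card := by
    simp [mul_comm]
  rw [hsum] at hle
  -- Without non-surjective sites, strictness comes from 3|C| < 4|C| ≤ |S|, with C nonempty;
  -- otherwise from the site missing in `T`.
  rcases hj₀ with h | h
  · have hT0 : T.card = 0 := by simp [T, h]
    have hS0 : 0 < S.card := by
      have := Fintype.card_pos (α := ι)
      simp only [h, Finset.card_empty] at hcard
      omega
    have hC0 : 0 < C.card := Finset.card_pos.2 ((Finset.card_pos.1 hS0).image κ)
    omega
  · have hT1 : T.card + 1 = Sᶜ.card := Finset.card_erase_add_one h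
    omega

end BlockSize

/-! ### Recognizing single-qubit and singlet factors -/

section Factors

theorem isFactor_of_forall {m n : ℕ} {φ : QubitSpace (Fin m)} {ψ : QubitSpace (Fin n)}
    (e : Fin m ↪ Fin n) (g : (Fin n → Fin 2) → ℂ)
    (hg : ∀ I I' : Fin n → Fin 2, (∀ k, k ∉ Finset.univ.map e → I k = I' k) → g I = g I')
    (h : ∀ I, ψ I = φ (fun k => I (e k)) * g I) : IsFactor φ ψ := by
  classical
  -- The value 0 at the sites of `e` is immaterial, as `g` ignores them.
  refine ⟨e, WithLp.toLp 2 fun A =>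
    g fun k => if hk : k ∉ Finset.univ.map e then A ⟨k, hk⟩ else 0, fun I => ?_⟩
  rw [h I]
  congr 1
  exact hg _ _ fun k hk => by simp only [dif_pos hk]

/-- The pair of slices of ψ at qubit `j` is everywhere proportional to (-q, p). -/
theorem hasSingleQubitFactor_of_linear_relation {n : ℕ} {ψ : QubitSpace (Fin n)} {j : Fin n}
    {p q : ℂ} (hpq : p ≠ 0 ∨ q ≠ 0)
    (h : ∀ I, p * ψ (Function.update I j 0) + q * ψ (Function.update I j 1) = 0) :
    HasSingleQubitFactor ψ := by
  have hupd : ∀ (I : Fin n → Fin 2) (a : Fin 2), I j = a → ψ I = ψ (Function.update I j a) := by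
    rintro I a rfl
    rw [Function.update_eq_self]
  let e : Fin 1 ↪ Fin n := ⟨fun _ => j, fun _ _ _ => Subsingleton.elim _ _⟩
  have he : ∀ i, e i = j := fun _ => rfl
  have hcongr : ∀ I I' : Fin n → Fin 2, (∀ k, k ∉ Finset.univ.map e → I k = I' k) →
      ∀ a, Function.update I j a = Function.update I' j a := by
    intro I I' hII a
    funext k
    by_cases hk : k = j
    · simp [hk]
    · simp [Function.update_of_ne hk, hII k (by simpa [he] using hk)]
  let g : (Fin n → Fin 2) → ℂ := fun I =>
    if p = 0 then -ψ (Function.update I j 0) / q else ψ (Function.update I j 1) / p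
  refine ⟨WithLp.toLp 2 fun A => if A 0 = 0 then -q else p,
    isFactor_of_forall e g (fun I I' hII => ?_) fun I => ?_⟩
  · simp only [g, hcongr I I' hII]
  · change ψ I = (if I j = 0 then -q else p) *
      (if p = 0 then -ψ (Function.update I j 0) / q else ψ (Function.update I j 1) / p)
    have hI := h I
    rcases Fin.exists_fin_two.1 ⟨I j, rfl⟩ with h0 | h0 <;> rw [h0] <;> by_cases hp : p = 0
    · have hq : q ≠ 0 := hpq.resolve_left (not_not.2 hp)
      simp only [if_true, if_pos hp]
      rw [← hupd I 0 h0]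
      field_simp
    · simp only [if_true, if_neg hp]
      rw [hupd I 0 h0]
      field_simp
      linear_combination hI
    · have hq : q ≠ 0 := hpq.resolve_left (not_not.2 hp)
      rw [hp, zero_mul, zero_add] at hI
      simp only [one_ne_zero, if_false, hp, zero_mul]
      rw [hupd I 1 h0]
      exact (mul_eq_zero.1 hI).resolve_left hq
    · simp only [one_ne_zero, if_false, if_neg hp]
      rw [← hupd I 1 h0]
      field_simp

/-- A nonzero traceless matrix is not scalar, so `pauliVector v - c` has a nonzero row, which is a
linear relation between the two slices. -/
theorem hasSingleQubitFactor_of_eigenvector {n : ℕ} {ψ : QubitSpace (Fin n)} {j : Fin n}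
    {v : Fin 3 → ℝ} (hv : v ≠ 0) {c : ℂ}
    (h : siteOp j (pauliVector v) (WithLp.ofLp ψ) = c • WithLp.ofLp ψ) :
    HasSingleQubitFactor ψ := by
  have h0 : ∀ I, (pauliVector v 0 0 - c) * ψ (Function.update I j 0) +
      pauliVector v 0 1 * ψ (Function.update I j 1) = 0 := fun I => by
    have := congrFun h (Function.update I j 0)
    simp [siteOp_apply] at this
    linear_combination this
  have h1 : ∀ I, pauliVector v 1 0 * ψ (Function.update I j 0) +
      (pauliVector v 1 1 - c) * ψ (Function.update I j 1) = 0 := fun I => by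
    have := congrFun h (Function.update I j 1)
    simp [siteOp_apply] at this
    linear_combination this
  by_cases h01 : pauliVector v 0 0 - c ≠ 0 ∨ pauliVector v 0 1 ≠ 0
  · exact hasSingleQubitFactor_of_linear_relation h01 h0
  · push Not at h01
    refine hasSingleQubitFactor_of_linear_relation (Or.inr fun h11 => hv ?_) h1
    have ha := h01.2
    have hb := sub_eq_zero.1 (show pauliVector v 0 0 - pauliVector v 1 1 = 0 by
      linear_combination h01.1 - h11)
    simp [pauliVector_apply, Complex.ext_iff] at ha hb
    ext i
    fin_cases i <;> simp <;> linarith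

theorem Matrix.eq_smul_one_of_commute_pauliVector {P : Matrix (Fin 2) (Fin 2) ℂ}
    (h : ∀ v, pauliVector v * P = P * pauliVector v) : P = P 0 0 • 1 := by
  have hI := Complex.I_ne_zero
  have h2 := h ![0, 0, 1]
  have h1 := h ![0, 1, 0]
  have e1 := congrFun (congrFun h2 0) 1
  have e2 := congrFun (congrFun h2 1) 0
  have e3 := congrFun (congrFun h1 1) 0
  simp [pauliVector_apply, Matrix.mul_apply, Fin.sum_univ_two] at e1 e2 e3
  have z1 : P 0 1 = 0 := by
    have : Complex.I * (2 * P 0 1) = 0 := by linear_combination -e1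
    simpa [hI] using this
  have z2 : P 1 0 = 0 := by
    have : Complex.I * (2 * P 1 0) = 0 := by linear_combination e2
    simpa [hI] using this
  ext a b
  fin_cases a <;> fin_cases b <;> simp [z1, z2, e3]

theorem conjTranspose_pauliVector (v : Fin 3 → ℝ) : (pauliVector v)ᴴ = -pauliVector v := by
  ext a b
  fin_cases a <;> fin_cases b <;> simp [pauliVector_apply, sub_eq_add_neg, add_comm]

open scoped ComplexOrder in
/-- If each `pauliVector v` is intertwined with some `pauliVector w` by all the matrices `N i`, then the
`N i` are multiples of a single special unitary
matrix. -/
theorem exists_specialUnitary_of_intertwining {α : Type*} {N : α → Matrix (Fin 2) (Fin 2) ℂ}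
    (hN : ∀ v, ∃ w, ∀ i, pauliVector v * N i = N i * pauliVector w) {i₀ : α} (h0 : N i₀ ≠ 0) :
    ∃ V ∈ Matrix.specialUnitaryGroup (Fin 2) ℂ, ∀ i, ∃ c : ℂ, N i = c • V := by
  -- By skew-Hermiticity the adjoint of the relation for `i₀` makes this product commute with all of
  -- su(2), so it is scalar.
  have hP : ∀ i, N i * (N i₀)ᴴ = (N i * (N i₀)ᴴ) 0 0 • 1 := by
    intro i
    refine Matrix.eq_smul_one_of_commute_pauliVector fun v => ?_
    obtain ⟨w, hw⟩ := hN v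
    have h2 := congrArg Matrix.conjTranspose (hw i₀)
    simp only [Matrix.conjTranspose_mul, conjTranspose_pauliVector, mul_neg, neg_mul,
      neg_inj] at h2
    rw [← mul_assoc, hw i, mul_assoc, ← h2, mul_assoc]
  set N₀ := N i₀ with hN₀
  set r : ℝ := Complex.normSq (N₀ 0 0) + Complex.normSq (N₀ 0 1) with hr
  have hr0 : N₀ * N₀ᴴ = (r : ℂ) • 1 := by
    rw [hP i₀, ← hN₀]
    congr 1
    simp [Matrix.mul_apply, Fin.sum_univ_two, hr, Complex.mul_conj]
  have hrpos : 0 < r := by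
    refine lt_of_le_of_ne (add_nonneg (Complex.normSq_nonneg _) (Complex.normSq_nonneg _))
      fun h => h0 ?_
    rw [← h, Complex.ofReal_zero, zero_smul] at hr0
    exact Matrix.self_mul_conjTranspose_eq_zero.1 hr0
  have hrc : (r : ℂ) ≠ 0 := by exact_mod_cast hrpos.ne'
  -- N₀ is √r times a unitary; dividing by a square root z of its determinant, with |z|² = r,
  -- normalizes it into SU(2).
  obtain ⟨z, hz⟩ := IsAlgClosed.exists_pow_nat_eq N₀.det (n := 2) (by norm_num)
  have hdet : N₀.det * star N₀.det = (r : ℂ) ^ 2 := by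
    rw [← Matrix.det_conjTranspose, ← Matrix.det_mul, hr0]
    simp
  have hzz : z * star z = r := by
    have h1 : (Complex.normSq z) ^ 2 = r ^ 2 := by
      have : ((Complex.normSq z : ℝ) : ℂ) ^ 2 = (r : ℂ) ^ 2 := by
        rw [← hdet, ← hz, ← Complex.mul_conj]
        simp
        ring
      exact_mod_cast this
    have h2 : Complex.normSq z = r :=
      (pow_left_inj₀ (Complex.normSq_nonneg z) hrpos.le two_ne_zero).1 h1
    rw [← h2]
    exact Complex.mul_conj z
  have hz0 : z ≠ 0 := by
    rintro rfl
    simp at hzz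
    exact hrpos.ne (by exact_mod_cast hzz)
  have hsz0 : star z ≠ 0 := star_ne_zero.2 hz0
  have hV : z⁻¹ • N₀ ∈ Matrix.specialUnitaryGroup (Fin 2) ℂ := by
    rw [Matrix.mem_specialUnitaryGroup_iff, Matrix.mem_unitaryGroup_iff]
    constructor
    · rw [Matrix.star_eq_conjTranspose, Matrix.conjTranspose_smul, smul_mul_smul_comm, hr0,
        smul_smul, star_inv₀, ← mul_inv, hzz, inv_mul_cancel₀ hrc, one_smul]
    · rw [Matrix.det_smul, Fintype.card_fin, ← hz]
      field_simp
  refine ⟨z⁻¹ • N₀, hV, fun i => ⟨(N i * N₀ᴴ) 0 0 * z / r, ?_⟩⟩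
  have hinv : N₀ᴴ * N₀ = (r : ℂ) • 1 := by
    have h1 : N₀ * ((r : ℂ)⁻¹ • N₀ᴴ) = 1 := by
      rw [mul_smul_comm, hr0, smul_smul, inv_mul_cancel₀ hrc, one_smul]
    have h2 := mul_eq_one_comm.1 h1
    rw [smul_mul_assoc] at h2
    rw [← h2, smul_smul, mul_inv_cancel₀ hrc, one_smul]
  have h3 : N i * (N₀ᴴ * N₀) = (N i * N₀ᴴ) 0 0 • N₀ := by
    rw [← mul_assoc, hP i]
    simp
  rw [hinv, mul_smul_comm, mul_one] at h3
  calc N i = (r : ℂ)⁻¹ • ((r : ℂ) • N i) := by rw [smul_smul, inv_mul_cancel₀ hrc, one_smul]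
    _ = _ := by
      rw [h3, smul_smul, smul_smul]
      congr 1
      field_simp

theorem localUnitaryAction_singlet {V : Matrix (Fin 2) (Fin 2) ℂ}
    (hV : V ∈ Matrix.specialUnitaryGroup (Fin 2) ℂ) (A : Fin 2 → Fin 2) :
    localUnitaryAction ((1, ![⟨V, hV⟩, 1]) : LocalUnitaryGroup (Fin 2)) singlet A =
      ((1 / Real.sqrt 2 : ℝ) : ℂ) * (V * !![0, 1; -1, 0] : Matrix (Fin 2) (Fin 2) ℂ) (A 0) (A 1) := by
  have hsum : ∀ F : (Fin 2 → Fin 2) → ℂ, ∑ J, F J =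
      F ![0, 0] + F ![0, 1] + F ![1, 0] + F ![1, 1] := by
    intro F
    rw [← (finTwoArrowEquiv (Fin 2)).symm.sum_comp, Fintype.sum_prod_type]
    simp [Fin.sum_univ_two, finTwoArrowEquiv]
    ring
  have e00 : (![0, 0] : Fin 2 → Fin 2) ≠ ![0, 1] := by decide
  have e01 : (![0, 0] : Fin 2 → Fin 2) ≠ ![1, 0] := by decide
  have e10 : (![1, 1] : Fin 2 → Fin 2) ≠ ![0, 1] := by decide
  have e11 : (![1, 1] : Fin 2 → Fin 2) ≠ ![1, 0] := by decide
  have e12 : (![0, 1] : Fin 2 → Fin 2) ≠ ![1, 0] := by decide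
  have s00 : singlet ![0, 0] = 0 := by simp [singlet, e00, e01]
  have s11 : singlet ![1, 1] = 0 := by simp [singlet, e10, e11]
  have s01 : singlet ![0, 1] = ((1 / Real.sqrt 2 : ℝ) : ℂ) := by simp [singlet, e12]
  have s10 : singlet ![1, 0] = -((1 / Real.sqrt 2 : ℝ) : ℂ) := by simp [singlet, e12.symm]
  simp only [localUnitaryAction, hsum, s00, s01, s10, s11, Fin.prod_univ_two]
  rcases Fin.exists_fin_two.1 ⟨A 1, rfl⟩ with h | h <;>
    simp [h, Matrix.mul_apply] <;> ring

/-- With the other qubits fixed, the coefficients at `b`, `c` form a matrix M satisfying E(v) M + M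
E(w)ᵀ = 0. Multiplying by the antisymmetric J turns this into an intertwining relation for N = M J,
so all N are multiples of one V in SU(2). Then M is a multiple of V J⁻¹, the coefficient matrix, up
to √2, of the singlet rotated by V on its first qubit. -/
theorem hasSingletFactor_of_pair {n : ℕ} {ψ : QubitSpace (Fin n)} (hψ : ψ ≠ 0) {b c : Fin n}
    (hbc : b ≠ c) (h : ∀ v, ∃ w, siteOp b (pauliVector v) (WithLp.ofLp ψ) +
      siteOp c (pauliVector w) (WithLp.ofLp ψ) = 0) : HasSingletFactor ψ := by
  let M : (Fin n → Fin 2) → Matrix (Fin 2) (Fin 2) ℂ := fun I =>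
    Matrix.of fun x y => ψ (Function.update (Function.update I b x) c y)
  have hM : ∀ I, ψ I = M I (I b) (I c) := fun I => by simp [M]
  let N : (Fin n → Fin 2) → Matrix (Fin 2) (Fin 2) ℂ := fun I => M I * !![0, -1; 1, 0]
  have hMN : ∀ I, M I = N I * !![0, 1; -1, 0] := fun I => by
    have : (!![0, -1; 1, 0] * !![0, 1; -1, 0] : Matrix (Fin 2) (Fin 2) ℂ) = 1 := by
      ext x y
      fin_cases x <;> fin_cases y <;> simp
    simp only [N]
    rw [mul_assoc, this, mul_one]
  have hN : ∀ v, ∃ w, ∀ I, pauliVector v * N I = N I * pauliVector w := by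
    intro v
    obtain ⟨w, hw⟩ := h v
    refine ⟨w, fun I => ?_⟩
    have key : ∀ x y, (pauliVector v * M I) x y + (M I * (pauliVector w)ᵀ) x y = 0 := by
      intro x y
      have := congrFun hw (Function.update (Function.update I b x) c y)
      simp only [Pi.add_apply, siteOp_apply, Fin.sum_univ_two, Function.update_self,
        Function.update_idem, Pi.zero_apply, Function.update_of_ne hbc] at this
      simp only [Matrix.mul_apply, Fin.sum_univ_two, M, Matrix.of_apply, Matrix.transpose_apply]
      simp only [Function.update_comm hbc] at this ⊢
      simp only [Function.update_idem] at this
      linear_combination this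
    have hE : pauliVector v * M I = -(M I * (pauliVector w)ᵀ) := by
      ext x y
      exact eq_neg_of_add_eq_zero_left (key x y)
    -- Self-duality of the spin-1/2 representation: J conjugates E(w)ᵀ to -E(w).
    have hJ : (pauliVector w)ᵀ * !![0, -1; 1, 0] = -(!![0, -1; 1, 0] * pauliVector w) := by
      ext x y
      fin_cases x <;> fin_cases y <;>
        simp [pauliVector_apply, Matrix.mul_apply, Fin.sum_univ_two]
    simp only [N]
    rw [← mul_assoc, hE, neg_mul, mul_assoc, hJ, mul_neg, neg_neg, mul_assoc]
  obtain ⟨I₀, hI₀⟩ : ∃ I, N I ≠ 0 := by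
    by_contra hcon
    push Not at hcon
    refine hψ ?_
    refine PiLp.ext fun I => ?_
    rw [hM, hMN, hcon]
    simp
  obtain ⟨V, hV, hc⟩ := exists_specialUnitary_of_intertwining hN hI₀
  choose g hg using hc
  have hV0 : V ≠ 0 := by
    rintro rfl
    simpa [hI₀] using hg I₀
  let e : Fin 2 ↪ Fin n := ⟨![b, c], by
    intro x y
    fin_cases x <;> fin_cases y <;> simp [hbc, hbc.symm]⟩
  have h2 : ((1 / Real.sqrt 2 : ℝ) : ℂ) ≠ 0 := by
    have : (0 : ℝ) < 1 / Real.sqrt 2 := by positivity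
    exact_mod_cast this.ne'
  refine ⟨_, ⟨(1, ![⟨V, hV⟩, 1]), rfl⟩, isFactor_of_forall e
    (fun I => g I / ((1 / Real.sqrt 2 : ℝ) : ℂ)) (fun I I' hII => ?_) fun I => ?_⟩
  · have hMM : M I = M I' := by
      ext x y
      simp only [M, Matrix.of_apply]
      refine congrArg (WithLp.ofLp ψ) (funext fun k => ?_)
      by_cases hkc : k = c
      · simp [hkc]
      · by_cases hkb : k = b
        · simp [hkb, Function.update_of_ne hbc]
        · have := hII k (by
            rw [Finset.mem_map]
            rintro ⟨i, -, rfl⟩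
            fin_cases i
            exacts [hkb rfl, hkc rfl])
          simp [Function.update_of_ne hkc, Function.update_of_ne hkb, this]
    have hgg : g I • V = g I' • V := by
      rw [← hg, ← hg]
      simp only [N, hMM]
    have hgI : g I = g I' := by
      have := sub_eq_zero.2 hgg
      rw [← sub_smul] at this
      exact sub_eq_zero.1 ((smul_eq_zero.1 this).resolve_right hV0)
    simp only [hgI]
  · rw [localUnitaryAction_singlet, hM I, hMN I, hg I, smul_mul_assoc, Matrix.smul_apply]
    rw [show e 0 = b from rfl, show e 1 = c from rfl, smul_eq_mul]
    field_simp

end Factors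

theorem mainTheorem2 (n : ℕ) (hn : 1 ≤ n) (ψ : QubitSpace (Fin n)) (hψ : ψ ≠ 0)
    (hsinglet : ¬ HasSingletFactor ψ) (hsingle : ¬ HasSingleQubitFactor ψ) :
    Module.finrank ℝ (stabilizerSubalgebra ψ) ≤ n - 1 := by
  have : Nonempty (Fin n) := ⟨⟨0, hn⟩⟩
  have hf : WithLp.ofLp ψ ≠ 0 := fun h => hψ (WithLp.ofLp_injective 2 h)
  have hlt := finrank_pauliStabilizer_lt hf
    (fun b c hbc h => hsinglet (hasSingletFactor_of_pair hψ hbc h))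
    (fun j v c hv h => hsingle (hasSingleQubitFactor_of_eigenvector hv h))
  rw [Fintype.card_fin] at hlt
  have hle := finrank_stabilizerSubalgebra_le ψ
  omega
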